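/- Let $n,m\ge 0$ be integers and let $g_0,g_1,\dots,g_m:\mathbb{R}^n\to\mathbb{R}^n$ be locally Lipschitz; $|\cdot|$ is the Euclidean norm. For $V:\mathbb{R}^n\to\mathbb{R}_{\ge 0}$ and $x\in\mathbb{R}^n$ let $\partial_D V(x)$ be the set of viscosity subgradients of $V$ at $x$, that is, of all $\zeta\in\mathbb{R}^n$ with $$\liminf_{h\to 0,\,h\ne 0}\frac{V(x+h)-V(x)-\zeta\cdot h}{|h|}\ge 0 .$$ For a system $\Sigma:\dot x=F(x,u)$ with states $x\in\mathbb{R}^n$ and inputs $u\in\mathbb{R}^m$, and for $\gamma\ge 0$, let $\mathcal{W}_\infty(\Sigma,\gamma)$ be the set of continuous functions $V:\mathbb{R}^n\to\mathbb{R}_{\ge 0}$ such that every sublevel set $\{x: V(x)\le a\}$, $a>0$, is compact ($V$ is proper), $V(x)=0$ if and only if $x=0$ ($V$ is positive definite), and $$\zeta\cdot F(x,u)\le -|x|^2+\gamma|u|^2\qquad\text{for all } x\ne 0,\ u\in\mathbb{R}^m,\ \zeta\in\partial_D V(x).$$ Let $\mathcal{C}^k_0$ ($k=1$ or $k=\infty$)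 be the set of continuous functions $V:\mathbb{R}^n\to\mathbb{R}_{\ge 0}$ that are of class $C^k$ on $\mathbb{R}^n\setminus\{0\}$. Then, for the input-affine system $$\Sigma:\quad \dot x=g_0(x)+\sum_{i=1}^m u_i\,g_i(x),$$ one has (with $\inf\emptyset=+\infty$) $$\inf\{\gamma\ge 0 : \mathcal{W}_\infty(\Sigma,\gamma)\ne\emptyset\}=\inf\{\gamma\ge 0 : \mathcal{W}_\infty(\Sigma,\gamma)\cap\mathcal{C}^1_0\ne\emptyset\};$$ moreover, if $\mathcal{W}_\infty(\Sigma,\gamma)\ne\emptyset$ for some $\gamma\ge 0$, then $\mathcal{W}_\infty(\Sigma,\gamma')\cap\mathcal{C}^\infty_0\ne\emptyset$ for every $\gamma'>\gamma$. More generally, both conclusions hold for every system $$\Sigma:\quad \dot x=g_0(x)+\sum_{i=1}^m \varphi(u_i)\,g_i(x),$$ where $\varphi(r)=|r|^p$ or $\varphi(r)=\operatorname{sign}(r)\,|r|^p$ (with $\varphi(0)=0$) and $p$ is a real number with $1\le p\le 2$. -/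

import Mathlib

open scoped Topology ContDiff

noncomputable section

namespace Dissipation

/-- `ℝᵏ` with its Euclidean norm and inner product. -/
abbrev Vec (k : ℕ) : Type := EuclideanSpace ℝ (Fin k)

/-- `ζ` is a viscosity subgradient of `V` at `x`:
`liminf_{h → 0, h ≠ 0} (V (x + h) - V x - ζ · h) / |h| ≥ 0`, the lower limit being taken in the
extended reals. -/
def IsViscositySubgradient {n : ℕ} (V : Vec n → ℝ) (x ζ : Vec n) : Prop :=
  0 ≤ Filter.liminf
    (fun h : Vec n => (((V (x + h) - V x - inner ℝ ζ h) / ‖h‖ : ℝ) : EReal)) (𝓝[≠] 0)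

/-- The viscosity subdifferential of `V` at `x` (possibly empty). -/
def viscositySubdifferential {n : ℕ} (V : Vec n → ℝ) (x : Vec n) : Set (Vec n) :=
  {ζ | IsViscositySubgradient V x ζ}

/-- `V` witnesses the gain `γ` for the system `ẋ = F(x, u)` with states in `ℝⁿ` and inputs
in `ℝᵐ`. -/
def WitnessesGain {n m : ℕ} (F : Vec n → Vec m → Vec n) (γ : ℝ) (V : Vec n → ℝ) : Prop :=
  ∀ x : Vec n, x ≠ 0 → ∀ u : Vec m, ∀ ζ ∈ viscositySubdifferential V x,
    inner ℝ ζ (F x u) ≤ -‖x‖ ^ 2 + γ * ‖u‖ ^ 2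

/-- The continuous nonnegative functions that witness the gain `γ`. -/
def storage {n m : ℕ} (F : Vec n → Vec m → Vec n) (γ : ℝ) : Set (Vec n → ℝ) :=
  {V | Continuous V ∧ (∀ x, 0 ≤ V x) ∧ WitnessesGain F γ V}

/-- Proper: every sublevel set `{x | V x ≤ a}`, `a > 0`, is compact. -/
def IsProperFun {n : ℕ} (V : Vec n → ℝ) : Prop :=
  ∀ a : ℝ, 0 < a → IsCompact {x | V x ≤ a}

/-- Positive definite: `V x = 0` exactly at the origin (for functions with values in `[0, ∞)`). -/
def IsPosDefFun {n : ℕ} (V : Vec n → ℝ) : Prop :=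
  ∀ x, V x = 0 ↔ x = 0

/-- The continuous, proper, positive definite functions that witness the gain `γ`. -/
def properStorage {n m : ℕ} (F : Vec n → Vec m → Vec n) (γ : ℝ) : Set (Vec n → ℝ) :=
  {V | V ∈ storage F γ ∧ IsProperFun V ∧ IsPosDefFun V}

/-- Continuous nonnegative functions on `ℝⁿ` that are of class `C^k` on `ℝⁿ \ {0}`. -/
def classOffOrigin (n : ℕ) (k : ℕ∞) : Set (Vec n → ℝ) :=
  {V | Continuous V ∧ (∀ x, 0 ≤ V x) ∧ ContDiffOn ℝ k V {0}ᶜ}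

/-- The infimum of the gains `γ ≥ 0` that satisfy `P`, in the extended reals (`∞` if there is no
such gain). -/
def infGain (P : ℝ → Prop) : EReal :=
  sInf ((fun γ : ℝ => (γ : EReal)) '' {γ | 0 ≤ γ ∧ P γ})

/-- The input-affine system `ẋ = g₀(x) + ∑ᵢ uᵢ gᵢ(x)`. -/
def affineSystem {n m : ℕ} (g₀ : Vec n → Vec n) (g : Fin m → Vec n → Vec n) :
    Vec n → Vec m → Vec n :=
  fun x u => g₀ x + ∑ i, u i • g i x

/-- The system `ẋ = g₀(x) + ∑ᵢ φ(uᵢ) gᵢ(x)`. -/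
def transformedSystem {n m : ℕ} (φ : ℝ → ℝ) (g₀ : Vec n → Vec n) (g : Fin m → Vec n → Vec n) :
    Vec n → Vec m → Vec n :=
  fun x u => g₀ x + ∑ i, φ (u i) • g i x

/-- `r ↦ |r|^p`. -/
def absPow (p : ℝ) : ℝ → ℝ := fun r => |r| ^ p

/-- `r ↦ sign(r) |r|^p`. -/
def signPow (p : ℝ) : ℝ → ℝ := fun r => Real.sign r * |r| ^ p

end Dissipation

end

open scoped Topology ContDiff

namespace Dissipation

/-! A larger gain leaves room for smoothing. If every error is at most `η x * (1 + ‖u‖ ^ 2)` with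
`η` small, then after multiplying `V` by a constant slightly above 1 the `x`-part of the error is
absorbed by `-‖x‖ ^ 2` and the `u`-part by `γ' - γ`. All that is asked of the system is that `F` be
bounded and Lipschitz in `x` on compact sets with constants of order `1 + ‖u‖ ^ 2`
(`HasQuadraticInputGrowth`); inputs entering through powers between 1 and 2 satisfy this.

On a compact set away from the origin, `V` is replaced by its inf-convolution with `‖·‖² / (2ε)`.
This is Lipschitz there, and wherever it is differentiable its gradient is a viscosity subgradient
of `V` at a nearby minimiser, so the dissipation inequality survives up to a small error
(`exists_lipschitz_approx`). By Rademacher's theorem it is differentiable almost everywhere, so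
convolution with a bump averages the inequality and gives a smooth approximation
(`exists_smooth_approx`).

A partition of unity on annuli glues these pieces over `ℝⁿ \ {0}`
(`exists_smooth_approx_off_origin`). The choice of `η` in `exists_smooth_properStorage` keeps the
result comparable with `V`, hence continuous at the origin, proper and positive definite. Equality
of the infima follows by letting `γ'` decrease to `γ`. -/

/-- Bounds on compact sets, uniform in the input up to the factor `1 + |u|²`. -/
def HasQuadraticInputGrowth {n m : ℕ} (F : Vec n → Vec m → Vec n) : Prop :=
  ∀ K : Set (Vec n), IsCompact K → ∃ L : ℝ, 0 ≤ L ∧ ∀ x ∈ K, ∀ u : Vec m,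
    ‖F x u‖ ≤ L * (1 + ‖u‖ ^ 2) ∧ ∀ y ∈ K, ‖F x u - F y u‖ ≤ L * (1 + ‖u‖ ^ 2) * ‖x - y‖

/-! ### Viscosity subgradients -/

theorem isViscositySubgradient_iff {n : ℕ} {V : Vec n → ℝ} {x ζ : Vec n} :
    IsViscositySubgradient V x ζ ↔
      ∀ ε : ℝ, 0 < ε → ∀ᶠ h in 𝓝 (0 : Vec n), -ε * ‖h‖ ≤ V (x + h) - V x - inner ℝ ζ h := by
  unfold IsViscositySubgradient
  rw [Filter.le_liminf_iff]
  constructor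
  · intro H ε hε
    have h1 := H ((-ε : ℝ) : EReal) (by exact_mod_cast neg_lt_zero.2 hε)
    rw [eventually_nhdsWithin_iff] at h1
    filter_upwards [h1] with h hh
    by_cases h0 : h = 0
    · simp [h0]
    · have := hh h0
      rw [EReal.coe_lt_coe_iff, lt_div_iff₀ (norm_pos_iff.2 h0)] at this
      exact this.le
  · intro H a ha
    obtain ⟨b, hab, hb⟩ := EReal.lt_iff_exists_real_btwn.1 ha
    have hb0 : b < 0 := by exact_mod_cast hb
    -- Half of `b` turns the non-strict bound into a strict one, since `‖h‖ > 0`.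
    have h1 := H (-b / 2) (by linarith)
    rw [eventually_nhdsWithin_iff]
    filter_upwards [h1] with h hh h0
    refine hab.trans ?_
    have hp : 0 < ‖h‖ := norm_pos_iff.2 h0
    rw [EReal.coe_lt_coe_iff, lt_div_iff₀ hp]
    nlinarith

/-- At a point of differentiability the derivative dominates every viscosity subgradient. -/
theorem IsViscositySubgradient.inner_le_of_hasFDerivAt {n : ℕ} {V : Vec n → ℝ} {x ζ : Vec n}
    (hζ : IsViscositySubgradient V x ζ) {D : Vec n →L[ℝ] ℝ} (hD : HasFDerivAt V D x) (v : Vec n) :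
    inner ℝ ζ v ≤ D v := by
  refine le_of_forall_pos_le_add fun e he => ?_
  -- The subgradient and the derivative each cost `ε * ‖t • v‖`; together, divided by `t`, at most
  -- `e`.
  set ε := e / (2 * (‖v‖ + 1)) with hεdef
  have hε : 0 < ε := by positivity
  have h1 := isViscositySubgradient_iff.1 hζ ε hε
  have h2 := (hasFDerivAt_iff_isLittleO_nhds_zero.1 hD).def hε
  have ht : Filter.Tendsto (fun t : ℝ => t • v) (𝓝[>] 0) (𝓝 0) := by
    have : Filter.Tendsto (fun t : ℝ => t • v) (𝓝 0) (𝓝 ((0 : ℝ) • v)) :=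
      (continuous_id.smul continuous_const).tendsto 0
    rw [zero_smul] at this
    exact this.mono_left nhdsWithin_le_nhds
  obtain ⟨t, ⟨ht1, ht2⟩, ht0⟩ :=
    ((ht.eventually (h1.and h2)).and self_mem_nhdsWithin).exists
  have ht0 : 0 < t := ht0
  rw [Real.norm_eq_abs] at ht2
  have h3 := (abs_le.1 ht2).2
  rw [norm_smul, Real.norm_of_nonneg ht0.le] at h3 ht1
  rw [inner_smul_right] at ht1
  rw [map_smul, smul_eq_mul] at h3
  have h4 : t * inner ℝ ζ v ≤ t * (D v + 2 * ε * ‖v‖) := by linarith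
  have h5 := le_of_mul_le_mul_left h4 ht0
  have h6 : 2 * ε * ‖v‖ ≤ e := by
    rw [hεdef]
    have : 2 * (e / (2 * (‖v‖ + 1))) * ‖v‖ = e * (‖v‖ / (‖v‖ + 1)) := by field_simp
    rw [this]
    have : ‖v‖ / (‖v‖ + 1) ≤ 1 := by
      rw [div_le_one (by positivity)]; linarith
    nlinarith
  linarith

/-! ### Inf-convolution -/

/-- The infimum in the inf-convolution of a nonnegative continuous function with
`‖·‖² / (2ε)` is attained. -/
theorem exists_forall_add_sq_le {n : ℕ} {V : Vec n → ℝ} (hV : Continuous V) (h0 : ∀ x, 0 ≤ V x)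
    {ε : ℝ} (hε : 0 < ε) (x : Vec n) :
    ∃ y, ∀ z, V y + ‖x - y‖ ^ 2 / (2 * ε) ≤ V z + ‖x - z‖ ^ 2 / (2 * ε) := by
  have hcont : Continuous fun z => V z + ‖x - z‖ ^ 2 / (2 * ε) := by fun_prop
  refine hcont.exists_forall_le_of_isBounded x ?_
  refine (Metric.isBounded_closedBall (x := x) (r := 2 * ε * V x + 1)).subset fun z hz => ?_
  simp only [Set.mem_ofPred_eq, sub_self, norm_zero, ne_eq, OfNat.ofNat_ne_zero, not_false_eq_true,
    zero_pow, zero_div, add_zero] at hz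
  have h1 : ‖x - z‖ ^ 2 / (2 * ε) ≤ V x := by linarith [h0 z]
  rw [div_le_iff₀ (by positivity)] at h1
  rw [Metric.mem_closedBall, dist_comm, dist_eq_norm]
  nlinarith [sq_nonneg (‖x - z‖ - 1), sq_nonneg (‖x - z‖)]

/-- At a point of differentiability of the inf-convolution `U`, its gradient is
`(x - y) / ε` for a minimiser `y`, and this is a viscosity subgradient of `V` at `y`. -/
theorem isViscositySubgradient_of_infConvolution {n : ℕ} {V U : Vec n → ℝ} {ε : ℝ} {x y : Vec n}
    (hU : ∀ x' z, U x' ≤ V z + ‖x' - z‖ ^ 2 / (2 * ε))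
    (hy : U x = V y + ‖x - y‖ ^ 2 / (2 * ε)) {D : Vec n →L[ℝ] ℝ} (hD : HasFDerivAt U D x) :
    (∀ v, D v = inner ℝ (ε⁻¹ • (x - y)) v) ∧ IsViscositySubgradient V y (ε⁻¹ • (x - y)) := by
  have hDv : ∀ v, D v = inner ℝ (ε⁻¹ • (x - y)) v := by
    -- With `y` frozen, this paraboloid touches `U` from above at `x`, so the two gradients agree
    -- there.
    have hq : HasFDerivAt (fun x' => V y + ‖x' - y‖ ^ 2 / (2 * ε))
        ((2 * ε)⁻¹ • (2 • (innerSL ℝ (x - y)))) x := by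
      have h1 : HasFDerivAt (fun x' : Vec n => x' - y) (ContinuousLinearMap.id ℝ _) x :=
        (hasFDerivAt_id x).sub_const y
      have h2 := (h1.norm_sq.const_mul ((2 * ε)⁻¹)).const_add (V y)
      simp only [ContinuousLinearMap.comp_id] at h2
      refine h2.congr_of_eventuallyEq (Filter.Eventually.of_forall fun x' => ?_)
      simp only [div_eq_inv_mul]
    have hmin : IsLocalMin (fun x' => V y + ‖x' - y‖ ^ 2 / (2 * ε) - U x') x := by
      refine Filter.Eventually.of_forall fun x' => ?_
      have := hU x' y
      simp only [← hy]
      linarith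
    have hzero := hmin.hasFDerivAt_eq_zero (hq.sub hD)
    intro v
    have := DFunLike.congr_fun (sub_eq_zero.1 hzero) v
    rw [← this]
    simp [inner_sub_left, inner_smul_left]
    ring
  refine ⟨hDv, isViscositySubgradient_iff.2 fun e he => ?_⟩
  have h2 := (hasFDerivAt_iff_isLittleO_nhds_zero.1 hD).def he
  filter_upwards [h2] with h hh
  rw [Real.norm_eq_abs] at hh
  have h3 := (abs_le.1 hh).1
  -- Moving both points by `h` leaves the quadratic term unchanged, so `V` grows from `y` at least
  -- as much as `U` does from `x`.
  have h4 := hU (x + h) (y + h)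
  rw [add_sub_add_right_eq_sub] at h4
  rw [← hDv h]
  linarith

/-! ### Lipschitz approximation near a compact set -/

open Metric in
/-- Lipschitz approximation near a compact set that misses the origin. -/
theorem exists_lipschitz_approx {n m : ℕ} {F : Vec n → Vec m → Vec n}
    (hF : HasQuadraticInputGrowth F) {γ : ℝ} {V : Vec n → ℝ} (hV : V ∈ storage F γ)
    {K : Set (Vec n)} (hK : IsCompact K) (hK0 : (0 : Vec n) ∉ K) {e : ℝ} (he : 0 < e) :
    ∃ (U : Vec n → ℝ) (C : NNReal) (δ : ℝ), LipschitzWith C U ∧ 0 < δ ∧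
      (∀ x ∈ K, |U x - V x| ≤ e) ∧
      ∀ x ∈ thickening δ K, DifferentiableAt ℝ U x → ∀ u,
        fderiv ℝ U x (F x u) ≤ -‖x‖ ^ 2 + γ * ‖u‖ ^ 2 + e * (1 + ‖u‖ ^ 2) := by
  obtain ⟨hVc, hV0, hVw⟩ := hV
  obtain ⟨δ₀, hδ₀, hsub⟩ := hK.exists_cthickening_subset_open
    (isOpen_compl_singleton (x := (0 : Vec n))) (fun x hx h => hK0 (h ▸ hx))
  -- Half the radius: minimisers lie within `δ` of their points, hence still in `K₁`, which misses
  -- the origin.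
  set δ := δ₀ / 2 with hδdef
  have hδ : 0 < δ := by positivity
  set K₁ := cthickening δ₀ K with hK₁
  have hK₁c : IsCompact K₁ := hK.cthickening
  obtain ⟨L, hL0, hL⟩ := hF K₁ hK₁c
  obtain ⟨M, hM⟩ := hK₁c.exists_bound_of_continuousOn hVc.continuousOn
  obtain ⟨R, hR⟩ := hK₁c.exists_bound_of_continuousOn (f := fun x : Vec n => x) continuousOn_id
  set e₁ := e / (4 * (L + 1)) with he₁def
  have he₁ : 0 < e₁ := by positivity
  obtain ⟨δ', hδ', huc⟩ := Metric.uniformContinuousOn_iff.1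
    (hK₁c.uniformContinuousOn_of_continuous hVc.continuousOn) e₁ he₁
  set e₂ := e / (4 * (|R| + 1)) with he₂def
  have he₂ : 0 < e₂ := by positivity
  set d := min δ (min δ' e₂) with hddef
  have hd : 0 < d := by positivity
  -- Chosen so that `2 * ε * |M| < d ^ 2`, which forces `‖x - y x‖ < d`.
  set ε := d ^ 2 / (4 * (|M| + 1)) with hεdef
  have hε : 0 < ε := by positivity
  choose y hy using exists_forall_add_sq_le hVc hV0 hε
  set U₀ : Vec n → ℝ := fun x => V (y x) + ‖x - y x‖ ^ 2 / (2 * ε) with hU₀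
  have hmin : ∀ x z, U₀ x ≤ V z + ‖x - z‖ ^ 2 / (2 * ε) := hy
  have hle : ∀ x, U₀ x ≤ V x := fun x => by simpa using hmin x x
  have hsubδ : cthickening δ K ⊆ K₁ := cthickening_mono (by linarith) K
  have hdist : ∀ x ∈ cthickening δ K, ‖x - y x‖ < d := by
    intro x hx
    have h1 := hle x
    simp only [hU₀] at h1
    have h2 : ‖x - y x‖ ^ 2 / (2 * ε) ≤ |M| := by
      have := hM x (hsubδ hx)
      rw [Real.norm_eq_abs] at this
      linarith [hV0 (y x), le_abs_self (V x), le_abs_self M]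
    rw [div_le_iff₀ (by positivity)] at h2
    have h3 : |M| * (2 * ε) < d ^ 2 := by
      rw [hεdef]
      have : |M| * (2 * (d ^ 2 / (4 * (|M| + 1)))) = d ^ 2 * (|M| / (2 * (|M| + 1))) := by
        field_simp; ring
      rw [this]
      have h5 : |M| / (2 * (|M| + 1)) < 1 := by
        rw [div_lt_one (by positivity)]; linarith [abs_nonneg M]
      nlinarith [pow_pos hd 2]
    exact lt_of_pow_lt_pow_left₀ 2 hd.le (h2.trans_lt h3)
  have hyK : ∀ x ∈ cthickening δ K, y x ∈ K₁ := by
    intro x hx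
    have h1 : y x ∈ cthickening δ (cthickening δ K) := by
      refine mem_cthickening_of_dist_le (y x) x δ _ hx ?_
      rw [dist_comm, dist_eq_norm]
      exact (hdist x hx).le.trans (min_le_left _ _)
    have h2 := cthickening_cthickening_subset hδ.le hδ.le K h1
    rwa [show δ + δ = δ₀ by rw [hδdef]; ring] at h2
  have hVdiff : ∀ x ∈ cthickening δ K, |V x - V (y x)| < e₁ := by
    intro x hx
    have := huc x (hsubδ hx) (y x) (hyK x hx) (by
      rw [dist_eq_norm]
      exact (hdist x hx).trans_le ((min_le_right _ _).trans (min_le_left _ _)))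
    rwa [Real.dist_eq] at this
  -- The decisive estimate: the penalty is at most `V x - V (y x)`, so `‖x - y x‖ ^ 2 / ε` is small,
  -- not just `‖x - y x‖`. It controls the gradient `(x - y x) / ε` paired with the change of `F`
  -- from `y x` to `x`.
  have hsq : ∀ x ∈ cthickening δ K, ‖x - y x‖ ^ 2 / (2 * ε) ≤ e₁ := by
    intro x hx
    have h1 := hle x
    simp only [hU₀] at h1
    linarith [(abs_lt.1 (hVdiff x hx)).2]
  have hLip : LipschitzOnWith (Real.toNNReal (2 * |R| / ε)) U₀ (cthickening δ K) := by
    refine LipschitzOnWith.of_le_add_mul _ fun x hx x' hx' => ?_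
    rw [Real.coe_toNNReal _ (by positivity), dist_eq_norm]
    have h1 := hmin x (y x')
    have h2 : ‖x - y x'‖ ^ 2 - ‖x' - y x'‖ ^ 2 ≤ ‖x - x'‖ * (4 * |R|) := by
      have a1 : ‖x - y x'‖ ≤ ‖x - x'‖ + ‖x' - y x'‖ := norm_sub_le_norm_sub_add_norm_sub _ _ _
      have a2 : ‖x - y x'‖ ≤ 2 * |R| := by
        linarith [norm_sub_le x (y x'), hR x (hsubδ hx), hR _ (hyK x' hx'), le_abs_self R]
      have a3 : ‖x' - y x'‖ ≤ 2 * |R| := by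
        linarith [norm_sub_le x' (y x'), hR x' (hsubδ hx'), hR _ (hyK x' hx'), le_abs_self R]
      nlinarith [norm_nonneg (x - y x'), norm_nonneg (x' - y x'), norm_nonneg (x - x')]
    have h3 : ‖x - y x'‖ ^ 2 / (2 * ε) - ‖x' - y x'‖ ^ 2 / (2 * ε)
        ≤ 2 * |R| / ε * ‖x - x'‖ := by
      rw [← sub_div, div_le_iff₀ (by positivity)]
      refine h2.trans (le_of_eq ?_)
      field_simp
      ring
    have h4 : U₀ x' = V (y x') + ‖x' - y x'‖ ^ 2 / (2 * ε) := rfl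
    linarith
  -- The extension makes the Lipschitz bound global, as mollification needs; derivatives are
  -- compared only in the open thickening, where `U` and `U₀` agree.
  obtain ⟨U, hUl, hUeq⟩ := hLip.extend_real
  have he₁e : e₁ ≤ e := by
    rw [he₁def]
    exact div_le_self he.le (by linarith)
  refine ⟨U, _, δ, hUl, hδ, fun x hx => ?_, fun x hx hdiff u => ?_⟩
  · have hx' := self_subset_cthickening (δ := δ) K hx
    rw [← hUeq hx', abs_le]
    have h1 := (abs_lt.1 (hVdiff x hx')).2
    have h2 : 0 ≤ ‖x - y x‖ ^ 2 / (2 * ε) := by positivity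
    have h3 := hle x
    simp only [hU₀] at h3 ⊢
    constructor <;> linarith
  · have hx' := thickening_subset_cthickening δ K hx
    have hev : U₀ =ᶠ[𝓝 x] U := by
      filter_upwards [isOpen_thickening.mem_nhds hx] with z hz
      exact hUeq (thickening_subset_cthickening δ K hz)
    have hD := hdiff.hasFDerivAt.congr_of_eventuallyEq hev
    obtain ⟨hDv, hsg⟩ := isViscositySubgradient_of_infConvolution hmin rfl hD
    have hyne : y x ≠ 0 := fun h => hsub (hyK x hx') h
    have h1 := hVw (y x) hyne u _ hsg
    have hu : 0 ≤ ‖u‖ ^ 2 := by positivity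
    have h2 : inner ℝ (ε⁻¹ • (x - y x)) (F x u - F (y x) u) ≤ e / 2 * (1 + ‖u‖ ^ 2) := by
      refine (real_inner_le_norm _ _).trans ?_
      rw [norm_smul, Real.norm_of_nonneg (by positivity)]
      have a1 := ((hL x (hsubδ hx') u).2 (y x) (hyK x hx'))
      have a2 := hsq x hx'
      have a3 : ε⁻¹ * ‖x - y x‖ * (L * (1 + ‖u‖ ^ 2) * ‖x - y x‖)
          = 2 * L * (1 + ‖u‖ ^ 2) * (‖x - y x‖ ^ 2 / (2 * ε)) := by
        field_simp
      have a4 : 2 * L * e₁ ≤ e / 2 := by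
        rw [he₁def]
        have : 2 * L * (e / (4 * (L + 1))) = e / 2 * (L / (L + 1)) := by field_simp; ring
        rw [this]
        have : L / (L + 1) ≤ 1 := by rw [div_le_one (by positivity)]; linarith
        nlinarith
      calc _ ≤ ε⁻¹ * ‖x - y x‖ * (L * (1 + ‖u‖ ^ 2) * ‖x - y x‖) := by gcongr
        _ = 2 * L * (1 + ‖u‖ ^ 2) * (‖x - y x‖ ^ 2 / (2 * ε)) := a3
        _ ≤ 2 * L * (1 + ‖u‖ ^ 2) * e₁ := by gcongr
        _ = (2 * L * e₁) * (1 + ‖u‖ ^ 2) := by ring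
        _ ≤ _ := by gcongr
    have h3 : ‖x‖ ^ 2 - ‖y x‖ ^ 2 ≤ e / 2 := by
      have a1 : ‖x‖ - ‖y x‖ ≤ ‖x - y x‖ := norm_sub_norm_le _ _
      have a2 : ‖x - y x‖ ≤ e₂ :=
        (hdist x hx').le.trans ((min_le_right _ _).trans (min_le_right _ _))
      have a3 : ‖x‖ ≤ |R| := (hR x (hsubδ hx')).trans (le_abs_self R)
      have a4 : ‖y x‖ ≤ |R| := (hR _ (hyK x hx')).trans (le_abs_self R)
      have a5 : e₂ * (2 * (|R| + 1)) = e / 2 := by rw [he₂def]; field_simp; ring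
      have a6 : (‖x‖ - ‖y x‖) * (‖x‖ + ‖y x‖) ≤ e₂ * (2 * (|R| + 1)) := by
        have : (‖x‖ - ‖y x‖) * (‖x‖ + ‖y x‖) ≤ e₂ * (‖x‖ + ‖y x‖) := by
          have := a1.trans a2
          gcongr
        refine this.trans ?_
        gcongr
        linarith
      nlinarith
    rw [hDv, ← sub_add_cancel (F x u) (F (y x) u), inner_add_right]
    nlinarith

/-! ### Mollification -/

open Metric MeasureTheory in
/-- The derivative of a mollified Lipschitz function is the mollified derivative. -/
theorem hasFDerivAt_mollify {n : ℕ} {U : Vec n → ℝ} {C : NNReal} (hU : LipschitzWith C U)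
    (φ : ContDiffBump (0 : Vec n)) (x : Vec n) :
    Integrable (fun t => φ.normed volume t • fderiv ℝ U (x - t)) ∧
    HasFDerivAt (convolution (φ.normed volume) U (ContinuousLinearMap.lsmul ℝ ℝ) volume)
      (∫ t, φ.normed volume t • fderiv ℝ U (x - t)) x := by
  have hφc : Continuous (φ.normed volume) := φ.continuous_normed
  have hcomp : HasCompactSupport (φ.normed volume) := φ.hasCompactSupport_normed
  have hcont : ∀ x', Continuous fun t => φ.normed volume t • U (x' - t) := fun x' =>
    hφc.smul (hU.continuous.comp (continuous_const.sub continuous_id))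
  refine hasFDerivAt_integral_of_dominated_loc_of_lip
    (F := fun x' t => φ.normed volume t • U (x' - t))
    (bound := fun t => φ.normed volume t * C) Filter.univ_mem
    (Filter.Eventually.of_forall fun x' => (hcont x').aestronglyMeasurable)
    ((hcont x).integrable_of_hasCompactSupport hcomp.smul_right) ?_ ?_ ?_ ?_
  · exact hφc.aestronglyMeasurable.smul
      ((measurable_fderiv ℝ U).comp (measurable_const.sub measurable_id)).aestronglyMeasurable
  · refine Filter.Eventually.of_forall fun t => LipschitzWith.lipschitzOnWith ?_
    refine LipschitzWith.of_dist_le_mul fun a b => ?_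
    have h1 := hU.dist_le_mul (a - t) (b - t)
    have h0 := φ.nonneg_normed (μ := volume) t
    rw [dist_sub_right] at h1
    rw [dist_smul₀, Real.coe_nnabs, abs_of_nonneg (by positivity), Real.norm_of_nonneg h0, mul_assoc]
    gcongr
  · exact φ.integrable_normed.mul_const _
  -- Rademacher's theorem, transported by the measure-preserving map `t ↦ x - t`.
  · have hae : ∀ᵐ t : Vec n, DifferentiableAt ℝ U (x - t) :=
      (Measure.measurePreserving_sub_left volume x).quasiMeasurePreserving.ae
        hU.ae_differentiableAt
    filter_upwards [hae] with t ht
    have h1 : HasFDerivAt (fun x' : Vec n => x' - t) (ContinuousLinearMap.id ℝ _) x :=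
      (hasFDerivAt_id x).sub_const t
    have h2 := (ht.hasFDerivAt.comp x h1).const_smul (φ.normed volume t)
    rw [ContinuousLinearMap.comp_id] at h2
    exact h2

open Metric MeasureTheory in
/-- Smooth approximation on a compact set that misses the origin. -/
theorem exists_smooth_approx {n m : ℕ} {F : Vec n → Vec m → Vec n}
    (hF : HasQuadraticInputGrowth F) {γ : ℝ} {V : Vec n → ℝ} (hV : V ∈ storage F γ)
    {K : Set (Vec n)} (hK : IsCompact K) (hK0 : (0 : Vec n) ∉ K) {e : ℝ} (he : 0 < e) :
    ∃ W : Vec n → ℝ, ContDiff ℝ ∞ W ∧ ∀ x ∈ K, |W x - V x| ≤ e ∧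
      ∀ u, fderiv ℝ W x (F x u) ≤ -‖x‖ ^ 2 + γ * ‖u‖ ^ 2 + e * (1 + ‖u‖ ^ 2) := by
  obtain ⟨U, C, δ, hU, hδ, hUV, hUd⟩ := exists_lipschitz_approx hF hV hK hK0 (half_pos he)
  obtain ⟨L, hL0, hL⟩ := hF _ (hK.cthickening (r := δ))
  obtain ⟨R, hR⟩ := (hK.cthickening (r := δ)).exists_bound_of_continuousOn
    (f := fun x : Vec n => x) continuousOn_id
  -- Error per unit of mollification radius: `2 * |R|` from `‖x‖ ^ 2`, `C * L` from `F`, `C` from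
  -- the values of `U`; the 1 keeps `Q` positive.
  set Q : ℝ := 2 * |R| + C * L + C + 1 with hQ
  have hQ0 : 0 < Q := by positivity
  set r := min δ (e / (2 * Q)) with hr
  have hr0 : 0 < r := by positivity
  have hrQ : r * Q ≤ e / 2 := by
    have : r ≤ e / (2 * Q) := min_le_right _ _
    calc r * Q ≤ e / (2 * Q) * Q := by gcongr
      _ = e / 2 := by field_simp
  let φ : ContDiffBump (0 : Vec n) := ⟨r / 2, r, by positivity, by linarith⟩
  refine ⟨convolution (φ.normed volume) U (ContinuousLinearMap.lsmul ℝ ℝ) volume, ?_,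
    fun x hx => ⟨?_, fun u => ?_⟩⟩
  · exact φ.hasCompactSupport_normed.contDiff_convolution_left _ φ.contDiff_normed
      hU.continuous.locallyIntegrable
  · have h1 := φ.dist_normed_convolution_le (μ := volume) (g := U) (x₀ := x) (ε := C * r)
      hU.continuous.aestronglyMeasurable fun z hz => (hU.dist_le_mul z x).trans (by
        have : dist z x ≤ r := (mem_ball.1 hz).le
        gcongr)
    rw [Real.dist_eq] at h1
    have h2 : C * r ≤ r * Q := by
      have : 0 ≤ r * (2 * |R| + C * L + 1) := by positivity
      rw [hQ]; linarith
    calc |_ - V x| ≤ |_ - U x| + |U x - V x| := abs_sub_le _ _ _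
      _ ≤ C * r + e / 2 := add_le_add h1 (hUV x hx)
      _ ≤ e := by linarith
  · obtain ⟨hint, hder⟩ := hasFDerivAt_mollify hU φ x
    rw [hder.fderiv, ContinuousLinearMap.integral_apply hint]
    set B := -‖x‖ ^ 2 + γ * ‖u‖ ^ 2 + e * (1 + ‖u‖ ^ 2) with hB
    -- The bound is an average of itself, so it suffices to compare integrands for almost every `t`.
    have hB1 : B = ∫ t, φ.normed volume t * B := by
      rw [integral_mul_const, φ.integral_normed, one_mul]
    rw [hB1]
    refine integral_mono_ae (hint.apply_continuousLinearMap _) (φ.integrable_normed.mul_const _) ?_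
    have hae : ∀ᵐ t : Vec n, DifferentiableAt ℝ U (x - t) :=
      (Measure.measurePreserving_sub_left volume x).quasiMeasurePreserving.ae
        hU.ae_differentiableAt
    filter_upwards [hae] with t ht
    simp only [FunLike.coe_smul, Pi.smul_apply, smul_eq_mul]
    by_cases htr : t ∈ ball (0 : Vec n) r
    · refine mul_le_mul_of_nonneg_left ?_ (φ.nonneg_normed t)
      have htn : ‖t‖ < r := by simpa using htr
      have hxt : x - t ∈ thickening δ K := by
        refine mem_thickening_iff.2 ⟨x, hx, ?_⟩
        rw [dist_eq_norm]
        simpa using htn.trans_le (min_le_left _ _)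
      have hxt' := thickening_subset_cthickening δ K hxt
      have hx' := self_subset_cthickening (δ := δ) K hx
      have h1 := hUd (x - t) hxt ht u
      have h2 := (hL x hx' u).2 (x - t) hxt'
      rw [sub_sub_cancel] at h2
      have h3 : fderiv ℝ U (x - t) (F x u - F (x - t) u) ≤ C * (L * (1 + ‖u‖ ^ 2) * r) := by
        refine (le_abs_self _).trans ?_
        rw [← Real.norm_eq_abs]
        refine (ContinuousLinearMap.le_opNorm _ _).trans ?_
        have := norm_fderiv_le_of_lipschitz ℝ hU (x₀ := x - t)
        have h4 : L * (1 + ‖u‖ ^ 2) * ‖t‖ ≤ L * (1 + ‖u‖ ^ 2) * r := by gcongr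
        exact mul_le_mul this (h2.trans h4) (norm_nonneg _) C.2
      have h4 : ‖x‖ ^ 2 - ‖x - t‖ ^ 2 ≤ r * (2 * |R|) := by
        have a1 : ‖x‖ - ‖x - t‖ ≤ ‖t‖ := by
          simpa using norm_sub_norm_le x (x - t)
        have a3 : ‖x‖ ≤ |R| := (hR x hx').trans (le_abs_self R)
        have a4 : ‖x - t‖ ≤ |R| := (hR _ hxt').trans (le_abs_self R)
        have a6 : (‖x‖ - ‖x - t‖) * (‖x‖ + ‖x - t‖) ≤ r * (‖x‖ + ‖x - t‖) := by
          have := a1.trans htn.le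
          gcongr
        have a7 : r * (‖x‖ + ‖x - t‖) ≤ r * (2 * |R|) := by gcongr; linarith
        nlinarith
      have hu : 0 ≤ ‖u‖ ^ 2 := by positivity
      have h5 : r * (2 * |R|) + C * (L * (1 + ‖u‖ ^ 2) * r) ≤ e / 2 * (1 + ‖u‖ ^ 2) := by
        calc r * (2 * |R|) + C * (L * (1 + ‖u‖ ^ 2) * r)
            ≤ r * (2 * |R|) * (1 + ‖u‖ ^ 2) + C * (L * (1 + ‖u‖ ^ 2) * r)
              + r * (C + 1) * (1 + ‖u‖ ^ 2) := by
              have : 0 ≤ r * (2 * |R|) * ‖u‖ ^ 2 := by positivity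
              have : 0 ≤ r * (C + 1) * (1 + ‖u‖ ^ 2) := by positivity
              linarith
          _ = r * Q * (1 + ‖u‖ ^ 2) := by rw [hQ]; ring
          _ ≤ _ := by gcongr
      rw [← sub_add_cancel (F x u) (F (x - t) u), map_add, hB]
      linarith
    · have h0 : φ.normed volume t = 0 := by
        by_contra h
        have : t ∈ Function.support (φ.normed volume) := h
        rw [φ.support_normed_eq] at this
        exact htr this
      simp [h0]

/-! ### Partition of unity on annuli and gluing -/

/-- A partition of unity on `ℝⁿ \ {0}`, subordinate to annuli. -/
noncomputable def annulusBump {n : ℕ} (k : ℤ) (x : Vec n) : ℝ :=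
  Real.smoothTransition (Real.log ‖x‖ - k + 1) - Real.smoothTransition (Real.log ‖x‖ - k)

/-- The closed annulus that carries `annulusBump k`. -/
def annulus (n : ℕ) (k : ℤ) : Set (Vec n) :=
  {x | Real.exp (k - 1) ≤ ‖x‖ ∧ ‖x‖ ≤ Real.exp (k + 1)}

theorem isCompact_annulus (n : ℕ) (k : ℤ) : IsCompact (annulus n k) := by
  refine Metric.isCompact_of_isClosed_isBounded
    ((isClosed_le continuous_const continuous_norm).inter
      (isClosed_le continuous_norm continuous_const))
    ((Metric.isBounded_closedBall (x := (0 : Vec n)) (r := Real.exp (k + 1))).subset ?_)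
  intro x hx
  simpa using hx.2

theorem ne_zero_of_mem_annulus {n : ℕ} {k : ℤ} {x : Vec n} (hx : x ∈ annulus n k) : x ≠ 0 := by
  rintro rfl
  have := hx.1
  rw [norm_zero] at this
  exact absurd this (not_le.2 (Real.exp_pos _))

theorem annulusBump_nonneg {n : ℕ} (k : ℤ) (x : Vec n) : 0 ≤ annulusBump k x :=
  sub_nonneg.2 (Real.smoothTransition.monotone (by linarith))

theorem abs_log_sub_lt_of_annulusBump_ne_zero {n : ℕ} {k : ℤ} {x : Vec n}
    (h : annulusBump k x ≠ 0) : |Real.log ‖x‖ - k| < 1 := by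
  contrapose! h
  rw [annulusBump]
  rcases le_abs'.1 h with h | h
  · rw [Real.smoothTransition.zero_of_nonpos (by linarith),
      Real.smoothTransition.zero_of_nonpos (by linarith), sub_zero]
  · rw [Real.smoothTransition.one_of_one_le (by linarith),
      Real.smoothTransition.one_of_one_le (by linarith), sub_self]

/-- The origin has to be excluded: since `Real.log 0 = 0`, `annulusBump 0` equals 1 there. -/
theorem mem_annulus_of_annulusBump_ne_zero {n : ℕ} {k : ℤ} {x : Vec n} (hx : x ≠ 0)
    (h : annulusBump k x ≠ 0) : x ∈ annulus n k := by
  obtain ⟨h1, h2⟩ := abs_lt.1 (abs_log_sub_lt_of_annulusBump_ne_zero h)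
  have hp := norm_pos_iff.2 hx
  exact ⟨(Real.le_log_iff_exp_le hp).1 (by linarith), (Real.log_le_iff_le_exp hp).1 (by linarith)⟩

theorem contDiffOn_annulusBump {n : ℕ} (k : ℤ) :
    ContDiffOn ℝ ∞ (annulusBump (n := n) k) {0}ᶜ := by
  intro x hx
  have hx0 : x ≠ 0 := hx
  have hl : ContDiffAt ℝ ∞ (fun x : Vec n => Real.log ‖x‖) x :=
    (contDiffAt_norm ℝ hx0).log (norm_ne_zero_iff.2 hx0)
  refine ContDiffAt.contDiffWithinAt (ContDiffAt.sub ?_ ?_)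
  · exact Real.smoothTransition.contDiffAt.comp x
      ((hl.sub contDiffAt_const).add contDiffAt_const)
  · exact Real.smoothTransition.contDiffAt.comp x (hl.sub contDiffAt_const)

/-- The three terms telescope. The condition on `x` is open, so the identity holds near each nonzero
point and can be differentiated. -/
theorem sum_annulusBump {n : ℕ} {k : ℤ} {x : Vec n} (h1 : (k : ℝ) - 1 < Real.log ‖x‖)
    (h2 : Real.log ‖x‖ < k + 1) : ∑ j ∈ Finset.Icc (k - 1) (k + 1), annulusBump j x = 1 := by
  have hS : Finset.Icc (k - 1) (k + 1) = {k - 1, k, k + 1} := by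
    ext j; simp only [Finset.mem_Icc, Finset.mem_insert, Finset.mem_singleton]; omega
  rw [hS, Finset.sum_insert (by simp; omega), Finset.sum_insert (by simp), Finset.sum_singleton]
  simp only [annulusBump]
  push_cast
  rw [Real.smoothTransition.one_of_one_le (x := Real.log ‖x‖ - (k - 1) + 1) (by linarith),
    Real.smoothTransition.zero_of_nonpos (x := Real.log ‖x‖ - (k + 1)) (by linarith),
    show Real.log ‖x‖ - (k - 1) = Real.log ‖x‖ - k + 1 by ring,
    show Real.log ‖x‖ - (k + 1) + 1 = Real.log ‖x‖ - k by ring]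
  ring

/-- The derivative of a blend of functions by a partition of unity; the constant `c` is
arbitrary because the derivatives of the weights sum to zero. -/
theorem hasFDerivAt_sum_mul_of_sum_eq_one {E ι : Type*} [NormedAddCommGroup E] [NormedSpace ℝ E]
    {S : Finset ι} {ψ W : ι → E → ℝ} {x : E} (hψ : ∀ j ∈ S, DifferentiableAt ℝ (ψ j) x)
    (hW : ∀ j ∈ S, DifferentiableAt ℝ (W j) x) (h1 : ∀ᶠ z in 𝓝 x, ∑ j ∈ S, ψ j z = 1) (c : ℝ) :
    HasFDerivAt (fun z => ∑ j ∈ S, ψ j z * W j z)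
      (∑ j ∈ S, (ψ j x • fderiv ℝ (W j) x + (W j x - c) • fderiv ℝ (ψ j) x)) x := by
  have hA : HasFDerivAt (fun z => ∑ j ∈ S, ψ j z * (W j z - c))
      (∑ j ∈ S, (ψ j x • fderiv ℝ (W j) x + (W j x - c) • fderiv ℝ (ψ j) x)) x :=
    HasFDerivAt.fun_sum fun j hj =>
      (hψ j hj).hasFDerivAt.mul ((hW j hj).hasFDerivAt.sub_const c)
  refine (hA.add_const c).congr_of_eventuallyEq ?_
  filter_upwards [h1] with z hz
  simp only [mul_sub, Finset.sum_sub_distrib, ← Finset.sum_mul, hz]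
  ring

/-- Smooth approximation on `ℝⁿ \ {0}` with a prescribed error function. -/
theorem exists_smooth_approx_off_origin {n m : ℕ} {F : Vec n → Vec m → Vec n}
    (hF : HasQuadraticInputGrowth F) {γ : ℝ} {V : Vec n → ℝ} (hV : V ∈ storage F γ)
    {η : Vec n → ℝ} (hη : Continuous η) (hη0 : ∀ x, x ≠ 0 → 0 < η x) :
    ∃ W : Vec n → ℝ, W 0 = 0 ∧ ContDiffOn ℝ ∞ W {0}ᶜ ∧ ∀ x, x ≠ 0 →
      |W x - V x| ≤ η x ∧
      ∀ u, fderiv ℝ W x (F x u) ≤ -‖x‖ ^ 2 + γ * ‖u‖ ^ 2 + η x * (1 + ‖u‖ ^ 2) := by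
  -- The tolerance on each annulus also pays for the derivative of the weight, which multiplies `W x
  -- - V x`. The share is `η x / 3` because three weights are summed at each point.
  have key : ∀ k : ℤ, ∃ W : Vec n → ℝ, ContDiff ℝ ∞ W ∧ ∀ x ∈ annulus n k,
      |W x - V x| ≤ η x ∧ ∀ u,
        annulusBump k x * fderiv ℝ W x (F x u) +
          (W x - V x) * fderiv ℝ (annulusBump k) x (F x u) ≤
        annulusBump k x * (-‖x‖ ^ 2 + γ * ‖u‖ ^ 2) + η x / 3 * (1 + ‖u‖ ^ 2) := by
    intro k
    have hc := isCompact_annulus n k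
    obtain ⟨a, ha, haη⟩ := hc.exists_forall_le' hη.continuousOn
      (a := 0) fun x hx => hη0 x (ne_zero_of_mem_annulus hx)
    have hdc : ContinuousOn (fderiv ℝ (annulusBump (n := n) k)) (annulus n k) :=
      ((contDiffOn_annulusBump k).continuousOn_fderiv_of_isOpen isOpen_compl_singleton
        (by simp)).mono fun x hx => ne_zero_of_mem_annulus hx
    obtain ⟨C, hC⟩ := hc.exists_bound_of_continuousOn hdc
    obtain ⟨L, hL0, hL⟩ := hF _ hc
    set e := a / (3 * (1 + |C| * L)) with hedef
    have he : 0 < e := by positivity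
    have hea : e * (1 + |C| * L) = a / 3 := by rw [hedef]; field_simp
    have hCL : 0 ≤ |C| * L := by positivity
    obtain ⟨W, hWs, hW⟩ := exists_smooth_approx hF hV hc
      (fun h => ne_zero_of_mem_annulus h rfl) he
    refine ⟨W, hWs, fun x hx => ⟨?_, fun u => ?_⟩⟩
    · refine (hW x hx).1.trans ?_
      nlinarith [haη x hx]
    · have hu : 0 ≤ ‖u‖ ^ 2 := by positivity
      have hb0 := annulusBump_nonneg k x
      have hb1 : annulusBump k x ≤ 1 := by
        rw [annulusBump]
        linarith [Real.smoothTransition.le_one (Real.log ‖x‖ - k + 1),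
          Real.smoothTransition.nonneg (Real.log ‖x‖ - k)]
      have h1 := mul_le_mul_of_nonneg_left ((hW x hx).2 u) hb0
      have h2 : (W x - V x) * fderiv ℝ (annulusBump k) x (F x u) ≤
          e * (|C| * (L * (1 + ‖u‖ ^ 2))) := by
        refine (le_abs_self _).trans ?_
        rw [abs_mul]
        have h3 : |fderiv ℝ (annulusBump k) x (F x u)| ≤ |C| * (L * (1 + ‖u‖ ^ 2)) := by
          rw [← Real.norm_eq_abs]
          refine (ContinuousLinearMap.le_opNorm _ _).trans ?_
          exact mul_le_mul ((hC x hx).trans (le_abs_self C)) (hL x hx u).1 (norm_nonneg _)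
            (abs_nonneg _)
        exact mul_le_mul (hW x hx).1 h3 (abs_nonneg _) he.le
      have h4 : annulusBump k x * (e * (1 + ‖u‖ ^ 2)) ≤ e * (1 + ‖u‖ ^ 2) :=
        mul_le_of_le_one_left (by positivity) hb1
      have h5 : e * (1 + ‖u‖ ^ 2) + e * (|C| * (L * (1 + ‖u‖ ^ 2))) ≤
          η x / 3 * (1 + ‖u‖ ^ 2) := by
        calc _ = e * (1 + |C| * L) * (1 + ‖u‖ ^ 2) := by ring
          _ = a / 3 * (1 + ‖u‖ ^ 2) := by rw [hea]
          _ ≤ _ := by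
            have := haη x hx
            gcongr
      linarith
  choose W hWs hW using key
  set G : Vec n → ℝ := fun x => if x = 0 then 0 else ∑ᶠ j, annulusBump j x * W j x with hG
  have hloc : ∀ x : Vec n, x ≠ 0 → ∃ k : ℤ, ∀ᶠ z in 𝓝 x, z ≠ 0 ∧
      ∑ j ∈ Finset.Icc (k - 1) (k + 1), annulusBump j z = 1 ∧
      G z = ∑ j ∈ Finset.Icc (k - 1) (k + 1), annulusBump j z * W j z := by
    intro x hx
    refine ⟨⌊Real.log ‖x‖⌋, ?_⟩
    set k := ⌊Real.log ‖x‖⌋ with hk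
    have hcont : ContinuousAt (fun z : Vec n => Real.log ‖z‖) x :=
      continuous_norm.continuousAt.log (norm_ne_zero_iff.2 hx)
    have hmem : Set.Ioo ((k : ℝ) - 1) (k + 1) ∈ 𝓝 (Real.log ‖x‖) :=
      Ioo_mem_nhds (by linarith [Int.floor_le (Real.log ‖x‖)]) (Int.lt_floor_add_one _)
    filter_upwards [hcont hmem, isOpen_compl_singleton.mem_nhds hx] with z hz hz0
    refine ⟨hz0, sum_annulusBump hz.1 hz.2, ?_⟩
    simp only [hG, if_neg (show z ≠ 0 from hz0)]
    refine finsum_eq_sum_of_support_subset _ fun j hj => ?_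
    have hj' : annulusBump j z ≠ 0 := left_ne_zero_of_mul hj
    obtain ⟨h1, h2⟩ := abs_lt.1 (abs_log_sub_lt_of_annulusBump_ne_zero hj')
    have h3 : (j : ℝ) < (k + 2 : ℤ) := by push_cast; linarith [hz.2]
    have h4 : ((k - 2 : ℤ) : ℝ) < j := by push_cast; linarith [hz.1]
    rw [Int.cast_lt] at h3 h4
    simp only [Finset.coe_Icc, Set.mem_Icc]
    omega
  refine ⟨G, by simp [hG], fun x hx => ?_, fun x hx => ?_⟩
  · obtain ⟨k, hk⟩ := hloc x hx
    refine ContDiffAt.contDiffWithinAt (ContDiffAt.congr_of_eventuallyEq ?_ (hk.mono fun z hz => hz.2.2))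
    exact ContDiffAt.sum fun j _ => ((contDiffOn_annulusBump j).contDiffAt
      (isOpen_compl_singleton.mem_nhds hx)).mul (hWs j).contDiffAt
  · obtain ⟨k, hk⟩ := hloc x hx
    obtain ⟨-, hsum, hGx⟩ := hk.self_of_nhds
    constructor
    · have h1 : G x - V x =
          ∑ j ∈ Finset.Icc (k - 1) (k + 1), annulusBump j x * (W j x - V x) := by
        simp only [mul_sub, Finset.sum_sub_distrib, ← Finset.sum_mul, hsum, hGx, one_mul]
      rw [h1]
      refine (Finset.abs_sum_le_sum_abs _ _).trans ?_
      calc _ ≤ ∑ j ∈ Finset.Icc (k - 1) (k + 1), annulusBump j x * η x := by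
            refine Finset.sum_le_sum fun j _ => ?_
            rw [abs_mul, abs_of_nonneg (annulusBump_nonneg j x)]
            by_cases hj : annulusBump j x = 0
            · simp [hj]
            · exact mul_le_mul_of_nonneg_left
                (hW j x (mem_annulus_of_annulusBump_ne_zero hx hj)).1 (annulusBump_nonneg j x)
        _ = η x := by rw [← Finset.sum_mul, hsum, one_mul]
    · intro u
      -- The free constant is taken to be `V x`, a number: only the small differences `W j x - V x`
      -- meet the derivatives of the weights, and `V` need not be differentiable.
      have hder := (hasFDerivAt_sum_mul_of_sum_eq_one
        (S := Finset.Icc (k - 1) (k + 1)) (ψ := fun j => annulusBump (n := n) j) (W := W) (x := x)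
        (fun j _ => ((contDiffOn_annulusBump j).contDiffAt
          (isOpen_compl_singleton.mem_nhds hx)).differentiableAt (by simp))
        (fun j _ => ((hWs j).differentiable (by simp)).differentiableAt)
        (hk.mono fun z hz => hz.2.1) (V x)).congr_of_eventuallyEq (hk.mono fun z hz => hz.2.2)
      rw [hder.fderiv]
      simp only [FunLike.coe_sum, Finset.sum_apply, FunLike.coe_add, FunLike.coe_smul,
        Pi.add_apply, Pi.smul_apply, smul_eq_mul]
      have hη3 : 0 ≤ η x / 3 * (1 + ‖u‖ ^ 2) := by
        have := hη0 x hx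
        positivity
      calc _ ≤ ∑ j ∈ Finset.Icc (k - 1) (k + 1),
            (annulusBump j x * (-‖x‖ ^ 2 + γ * ‖u‖ ^ 2) + η x / 3 * (1 + ‖u‖ ^ 2)) := by
            refine Finset.sum_le_sum fun j _ => ?_
            by_cases hj : annulusBump j x = 0
            -- A nonnegative weight has a minimum where it vanishes, so its derivative vanishes too
            -- and no bound on `W j` is needed.
            · have hmin : IsLocalMin (annulusBump (n := n) j) x :=
                Filter.Eventually.of_forall fun z => hj ▸ annulusBump_nonneg j z
              rw [hmin.fderiv_eq_zero, hj]
              simpa using hη3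
            · exact (hW j x (mem_annulus_of_annulusBump_ne_zero hx hj)).2 u
        _ = _ := by
            rw [Finset.sum_add_distrib, ← Finset.sum_mul, hsum, Finset.sum_const, Int.card_Icc,
              show (k + 1 + 1 - (k - 1)).toNat = 3 by omega]
            simp only [nsmul_eq_mul]
            push_cast
            ring

/-! ### Smooth storage functions and equality of the infima -/

/-- A larger gain has a proper storage function that is smooth off the origin. -/
theorem exists_smooth_properStorage {n m : ℕ} {F : Vec n → Vec m → Vec n}
    (hF : HasQuadraticInputGrowth F) {γ γ' : ℝ} (hγ : 0 ≤ γ) (hγγ' : γ < γ')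
    (h : (properStorage F γ).Nonempty) :
    (properStorage F γ' ∩ classOffOrigin n (⊤ : ℕ∞)).Nonempty := by
  obtain ⟨V, hV, hVp, hVd⟩ := h
  obtain ⟨hVc, hV0, -⟩ := id hV
  have hVpos : ∀ x, x ≠ 0 → 0 < V x := fun x hx =>
    lt_of_le_of_ne (hV0 x) fun h => hx ((hVd x).1 h.symm)
  -- The scaling `c = 1 + s` gains `s * ‖x‖ ^ 2` of decay at the price of the gain `c * γ`, which
  -- stays below `γ'`; the remainder `b` is left for the error in `‖u‖ ^ 2`.
  set s := (γ' - γ) / (2 * (γ + 1)) with hs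
  have hs0 : 0 < s := div_pos (by linarith) (by linarith)
  set c := 1 + s with hc
  have hc0 : 0 < c := by linarith
  have hcγ : c * γ < γ' := by
    have h1 : s * (2 * (γ + 1)) = γ' - γ := by rw [hs]; field_simp
    nlinarith
  set b := γ' - c * γ with hb
  have hb0 : 0 < b := by linarith
  -- The three bounds give `c * η ≤ s * ‖x‖ ^ 2`, `c * η ≤ b`, and `V / 2 ≤ W ≤ 3 * V / 2`; the last
  -- yields properness, definiteness and continuity at the origin.
  set η : Vec n → ℝ := fun x => min (min (s / c * ‖x‖ ^ 2) (b / c)) (V x / 2) with hη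
  have hηc : Continuous η := by fun_prop
  have hηpos : ∀ x, x ≠ 0 → 0 < η x := fun x hx => by
    have h1 := norm_pos_iff.2 hx
    have h2 := hVpos x hx
    positivity
  obtain ⟨W, hW0, hWs, hW⟩ := exists_smooth_approx_off_origin hF hV hηc hηpos
  have hV00 : V 0 = 0 := (hVd 0).2 rfl
  have hclose : ∀ x, |W x - V x| ≤ V x / 2 := fun x => by
    by_cases hx : x = 0
    · simp [hx, hW0, hV00]
    · exact (hW x hx).1.trans (min_le_right _ _)
  have hlow : ∀ x, V x / 2 ≤ W x := fun x => by linarith [(abs_le.1 (hclose x)).1]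
  have hWn : ∀ x, 0 ≤ W x := fun x => by linarith [hlow x, hV0 x]
  have hWc : Continuous W := by
    refine continuous_iff_continuousAt.2 fun x => ?_
    by_cases hx : x = 0
    · subst hx
      rw [ContinuousAt, hW0]
      have hlim : Filter.Tendsto (fun x => 2 * V x) (𝓝 0) (𝓝 0) := by
        have := (hVc.const_mul 2).tendsto 0
        simpa [hV00] using this
      refine squeeze_zero hWn (fun x => ?_) hlim
      linarith [(abs_le.1 (hclose x)).2, hV0 x]
    · exact hWs.continuousOn.continuousAt (isOpen_compl_singleton.mem_nhds hx)
  have hZc : Continuous fun x => c * W x := hWc.const_mul c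
  have hZn : ∀ x, 0 ≤ c * W x := fun x => mul_nonneg hc0.le (hWn x)
  have hZs : ContDiffOn ℝ ∞ (fun x => c * W x) {0}ᶜ := contDiffOn_const.mul hWs
  refine ⟨fun x => c * W x, ⟨⟨hZc, hZn, ?_⟩, ?_, ?_⟩, hZc, hZn, hZs⟩
  · intro x hx u ζ hζ
    have hd : HasFDerivAt (fun x => c * W x) (c • fderiv ℝ W x) x :=
      (((hWs.contDiffAt (isOpen_compl_singleton.mem_nhds hx)).differentiableAt
        (by simp)).hasFDerivAt).const_mul c
    have hsub : IsViscositySubgradient (fun x => c * W x) x ζ := hζ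
    refine (hsub.inner_le_of_hasFDerivAt hd (F x u)).trans ?_
    rw [FunLike.coe_smul, Pi.smul_apply, smul_eq_mul]
    have h1 := mul_le_mul_of_nonneg_left ((hW x hx).2 u) hc0.le
    refine h1.trans ?_
    have hu : 0 ≤ ‖u‖ ^ 2 := by positivity
    have h2 : c * η x ≤ s * ‖x‖ ^ 2 := by
      calc c * η x ≤ c * (s / c * ‖x‖ ^ 2) := by
            gcongr
            exact (min_le_left _ _).trans (min_le_left _ _)
        _ = s * ‖x‖ ^ 2 := by field_simp
    have h3 : c * η x ≤ b := by
      calc c * η x ≤ c * (b / c) := by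
            gcongr
            exact (min_le_left _ _).trans (min_le_right _ _)
        _ = b := by field_simp
    have h4 := mul_le_mul_of_nonneg_right h3 hu
    rw [hb] at h4
    rw [hc] at h2 h4 ⊢
    linarith
  · intro a ha
    refine (hVp (2 * a / c) (by positivity)).of_isClosed_subset
      (isClosed_le hZc continuous_const) fun x hx => ?_
    have hx' : c * W x ≤ a := hx
    change V x ≤ 2 * a / c
    rw [le_div_iff₀ hc0]
    nlinarith [hlow x]
  · intro x
    constructor
    · intro h
      by_contra hx
      have h1 := hVpos x hx
      have h2 : 0 < W x := by linarith [hlow x]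
      exact absurd h (mul_pos hc0 h2).ne'
    · rintro rfl
      simp [hW0]

/-- Smooth witnesses may be missing at an admissible `γ` but exist at every larger gain, so the
infimum is unaffected. -/
theorem infGain_properStorage_eq {n m : ℕ} {F : Vec n → Vec m → Vec n}
    (hF : HasQuadraticInputGrowth F) :
    infGain (fun γ => (properStorage F γ).Nonempty) =
      infGain (fun γ => (properStorage F γ ∩ classOffOrigin n 1).Nonempty) := by
  refine le_antisymm ?_ ?_
  · refine sInf_le_sInf (Set.image_mono ?_)
    rintro γ ⟨h0, V, hV⟩
    exact ⟨h0, V, hV.1⟩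
  · refine le_sInf ?_
    rintro _ ⟨γ, ⟨h0, hne⟩, rfl⟩
    refine EReal.le_of_forall_lt_iff_le.1 fun γ' hγ' => ?_
    have hγ' : γ < γ' := EReal.coe_lt_coe_iff.1 hγ'
    obtain ⟨V, hV, hVc, hVn, hVs⟩ := exists_smooth_properStorage hF h0 hγ' hne
    exact sInf_le ⟨γ', ⟨h0.trans hγ'.le, V, hV, hVc, hVn,
      hVs.of_le (by exact_mod_cast le_top)⟩, rfl⟩

/-! ### Growth bounds for the systems of the theorem -/

/-- On a compact set a locally Lipschitz field is bounded and Lipschitz with a single constant; the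
input enters only as the factors `φ (u i)`, each at most `1 + ‖u‖ ^ 2` in absolute value. -/
theorem hasQuadraticInputGrowth_transformedSystem {n m : ℕ} {φ : ℝ → ℝ} {g₀ : Vec n → Vec n}
    {g : Fin m → Vec n → Vec n} (hφ : ∀ r, |φ r| ≤ 1 + r ^ 2) (hg₀ : LocallyLipschitz g₀)
    (hg : ∀ i, LocallyLipschitz (g i)) : HasQuadraticInputGrowth (transformedSystem φ g₀ g) := by
  intro K hK
  have key : ∀ f : Vec n → Vec n, LocallyLipschitz f → ∃ L : ℝ, 0 ≤ L ∧ ∀ x ∈ K,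
      ‖f x‖ ≤ L ∧ ∀ y ∈ K, ‖f x - f y‖ ≤ L * ‖x - y‖ := by
    intro f hf
    obtain ⟨A, hA⟩ := hK.exists_bound_of_continuousOn hf.continuous.continuousOn
    obtain ⟨C, hC⟩ := (hf.locallyLipschitzOn (s := K)).exists_lipschitzOnWith_of_compact hK
    refine ⟨|A| + C, by positivity, fun x hx => ⟨?_, fun y hy => ?_⟩⟩
    · exact ((hA x hx).trans (le_abs_self A)).trans (by simp)
    · refine (hC.norm_sub_le hx hy).trans ?_
      gcongr
      simp
  obtain ⟨L₀, hL₀, h₀⟩ := key g₀ hg₀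
  choose L hL h using fun i => key (g i) (hg i)
  have hφu : ∀ (u : Vec m) i, |φ (u i)| ≤ 1 + ‖u‖ ^ 2 := fun u i => by
    refine (hφ _).trans ?_
    have h1 := PiLp.norm_apply_le u i
    rw [Real.norm_eq_abs] at h1
    have h2 : (u i) ^ 2 ≤ ‖u‖ ^ 2 := sq_le_sq.2 (by rwa [abs_norm])
    linarith
  have hsum : 0 ≤ ∑ i, L i := Finset.sum_nonneg fun i _ => hL i
  refine ⟨L₀ + ∑ i, L i, by positivity, fun x hx u => ⟨?_, fun y hy => ?_⟩⟩
  · calc ‖transformedSystem φ g₀ g x u‖ ≤ ‖g₀ x‖ + ∑ i, ‖φ (u i) • g i x‖ :=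
          (norm_add_le _ _).trans (by gcongr; exact norm_sum_le _ _)
      _ ≤ L₀ * (1 + ‖u‖ ^ 2) + ∑ i, L i * (1 + ‖u‖ ^ 2) := by
          refine add_le_add ?_ (Finset.sum_le_sum fun i _ => ?_)
          · have := (h₀ x hx).1
            nlinarith [sq_nonneg ‖u‖]
          · rw [norm_smul, Real.norm_eq_abs, mul_comm]
            exact mul_le_mul (h i x hx).1 (hφu u i) (abs_nonneg _) (hL i)
      _ = _ := by rw [← Finset.sum_mul]; ring
  · have hdiff : transformedSystem φ g₀ g x u - transformedSystem φ g₀ g y u =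
        (g₀ x - g₀ y) + ∑ i, φ (u i) • (g i x - g i y) := by
      simp only [transformedSystem, smul_sub, Finset.sum_sub_distrib]
      abel
    rw [hdiff]
    calc _ ≤ ‖g₀ x - g₀ y‖ + ∑ i, ‖φ (u i) • (g i x - g i y)‖ :=
          (norm_add_le _ _).trans (by gcongr; exact norm_sum_le _ _)
      _ ≤ L₀ * (1 + ‖u‖ ^ 2) * ‖x - y‖ + ∑ i, L i * (1 + ‖u‖ ^ 2) * ‖x - y‖ := by
          refine add_le_add ?_ (Finset.sum_le_sum fun i _ => ?_)
          · refine ((h₀ x hx).2 y hy).trans ?_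
            gcongr
            nlinarith [sq_nonneg ‖u‖]
          · rw [norm_smul, Real.norm_eq_abs]
            calc _ ≤ (1 + ‖u‖ ^ 2) * (L i * ‖x - y‖) :=
                  mul_le_mul (hφu u i) ((h i x hx).2 y hy) (norm_nonneg _) (by positivity)
              _ = _ := by ring
      _ = _ := by rw [← Finset.sum_mul, ← Finset.sum_mul]; ring

theorem abs_rpow_le_one_add_sq {p : ℝ} (h1 : 1 ≤ p) (h2 : p ≤ 2) (r : ℝ) :
    |r| ^ p ≤ 1 + r ^ 2 := by
  rcases le_total |r| 1 with h | h
  · have := Real.rpow_le_one (abs_nonneg r) h (by linarith : 0 ≤ p)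
    nlinarith [sq_nonneg r]
  · have := Real.rpow_le_rpow_of_exponent_le h h2
    rw [Real.rpow_two, sq_abs] at this
    linarith

theorem abs_absPow_le {p : ℝ} (h1 : 1 ≤ p) (h2 : p ≤ 2) (r : ℝ) : |absPow p r| ≤ 1 + r ^ 2 := by
  rw [absPow, abs_of_nonneg (by positivity)]
  exact abs_rpow_le_one_add_sq h1 h2 r

theorem abs_signPow_le {p : ℝ} (h1 : 1 ≤ p) (h2 : p ≤ 2) (r : ℝ) : |signPow p r| ≤ 1 + r ^ 2 := by
  rw [signPow, abs_mul, abs_of_nonneg (by positivity : 0 ≤ |r| ^ p)]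
  refine le_trans (mul_le_of_le_one_left (by positivity) ?_) (abs_rpow_le_one_add_sq h1 h2 r)
  rcases Real.sign_apply_eq r with h | h | h <;> simp [h]

theorem affineSystem_eq_transformedSystem {n m : ℕ} (g₀ : Vec n → Vec n)
    (g : Fin m → Vec n → Vec n) : affineSystem g₀ g = transformedSystem id g₀ g := rfl

theorem hasQuadraticInputGrowth_affineSystem {n m : ℕ} {g₀ : Vec n → Vec n}
    {g : Fin m → Vec n → Vec n} (hg₀ : LocallyLipschitz g₀) (hg : ∀ i, LocallyLipschitz (g i)) :
    HasQuadraticInputGrowth (affineSystem g₀ g) := by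
  rw [affineSystem_eq_transformedSystem]
  refine hasQuadraticInputGrowth_transformedSystem (fun r => abs_le.2 ⟨?_, ?_⟩) hg₀ hg <;>
    simp only [id] <;> nlinarith [sq_nonneg (r - 1), sq_nonneg (r + 1)]

end Dissipation

theorem theorem1 (n m : ℕ)
    (g₀ : Dissipation.Vec n → Dissipation.Vec n)
    (g : Fin m → Dissipation.Vec n → Dissipation.Vec n)
    (hg₀ : LocallyLipschitz g₀) (hg : ∀ i, LocallyLipschitz (g i)) :
    -- input-affine systems
    (Dissipation.infGain
          (fun γ => (Dissipation.properStorage (Dissipation.affineSystem g₀ g) γ).Nonempty) =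
        Dissipation.infGain
          (fun γ => (Dissipation.properStorage (Dissipation.affineSystem g₀ g) γ ∩
            Dissipation.classOffOrigin n 1).Nonempty) ∧
      ∀ γ γ' : ℝ, 0 ≤ γ → γ < γ' →
        (Dissipation.properStorage (Dissipation.affineSystem g₀ g) γ).Nonempty →
        (Dissipation.properStorage (Dissipation.affineSystem g₀ g) γ' ∩
          Dissipation.classOffOrigin n (⊤ : ℕ∞)).Nonempty) ∧
    -- systems with powers of the inputs
    (∀ p : ℝ, 1 ≤ p → p ≤ 2 → ∀ φ : ℝ → ℝ,
      φ = Dissipation.absPow p ∨ φ = Dissipation.signPow p →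
      (Dissipation.infGain
          (fun γ => (Dissipation.properStorage
            (Dissipation.transformedSystem φ g₀ g) γ).Nonempty) =
        Dissipation.infGain
          (fun γ => (Dissipation.properStorage (Dissipation.transformedSystem φ g₀ g) γ ∩
            Dissipation.classOffOrigin n 1).Nonempty) ∧
      ∀ γ γ' : ℝ, 0 ≤ γ → γ < γ' →
        (Dissipation.properStorage (Dissipation.transformedSystem φ g₀ g) γ).Nonempty →
        (Dissipation.properStorage (Dissipation.transformedSystem φ g₀ g) γ' ∩
          Dissipation.classOffOrigin n (⊤ : ℕ∞)).Nonempty)) := by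
  refine ⟨?_, fun p hp1 hp2 φ hφ => ?_⟩
  · have hF := Dissipation.hasQuadraticInputGrowth_affineSystem hg₀ hg
    exact ⟨Dissipation.infGain_properStorage_eq hF,
      fun γ γ' => Dissipation.exists_smooth_properStorage hF⟩
  · have hb : ∀ r, |φ r| ≤ 1 + r ^ 2 := by
      rcases hφ with rfl | rfl
      · exact Dissipation.abs_absPow_le hp1 hp2
      · exact Dissipation.abs_signPow_le hp1 hp2
    have hF := Dissipation.hasQuadraticInputGrowth_transformedSystem hb hg₀ hg
    exact ⟨Dissipation.infGain_properStorage_eq hF,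
      fun γ γ' => Dissipation.exists_smooth_properStorage hF⟩
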